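/- Let $W\sim\mathcal P_W$ be a random parameter in a measurable space $\mathcal W$, and let $X$, with values in a measurable space $\mathcal X$, be drawn from $\mathcal P_{X|W=w}$ given $W=w$, where $\mathcal P_{X|W}$ is a Markov kernel. Let $\ell:\mathcal W\times\hat{\mathcal W}\to[0,\infty)$ be a jointly measurable loss. For an estimator, i.e. a measurable map $\phi:\mathcal X\to\hat{\mathcal W}$, put $\hat W=\phi(X)$, let $R(\phi)=\mathbb E[\ell(W,\hat W)]$ be its risk, and let $$L_{\hat W}(\rho)=\sup_{w\in\mathcal W}\mathcal P_{\hat W}\big(\ell(w,\hat W)<\rho\big)$$ be the small-ball probability of $\hat W$. The Bayesian risk is $R_B=\inf_\phi R(\phi)$, the infimum over all estimators. For $\alpha>1$ the Rényi divergence is $D_\alpha(P\|Q)=\frac1{\alpha-1}\log\int p^\alpha q^{1-\alpha}\,d\mu$, where $p,q$ are the densities of $P,Q$ with respect to a common dominating measure $\mu$, and Sibson's mutual information is $I_\alpha(X,W)=\inf_{\mathcal Q_W}D_\alpha(\mathcal P_{XW}\|\mathcal P_X\otimes\mathcal Q_W)$, over all probability measures $\mathcal Q_W$ on $\mathcal W$.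 The maximal leakage from $X$ to $W$ is $$\mathcal L(X\to W)=\sup_{U-X-W-\hat U}\log\frac{\mathbb P(U=\hat U)}{\max_u\mathbb P(U=u)},$$ the supremum over all Markov chains $U-X-W-\hat U$ with $U,\hat U$ in a common, arbitrary finite alphabet. All these quantities may be infinite; $\log 0=-\infty$, $\exp(-\infty)=0$, $\exp(\infty)=\infty$. Then for every $\alpha>1$, every $\rho>0$ and every estimator $\hat W=\phi(X)$, $$R(\phi)\ \ge\ \rho\left(1-\exp\left(\frac{\alpha-1}{\alpha}\big(I_\alpha(X,W)+\log L_{\hat W}(\rho)\big)\right)\right),$$ and, in the case $\alpha\to\infty$, $$R(\phi)\ \ge\ \rho\Big(1-\exp\big(\mathcal L(X\to W)+\log L_{\hat W}(\rho)\big)\Big).$$ Moreover, let $\Phi$ be any set of estimators with $\inf_{\phi\in\Phi}R(\phi)=R_B$ (for instance the set of all estimators, or a single Bayes-optimal estimator). Then both bounds hold with $R_B$ in place of $R(\phi)$ and with $\sup_{\phi\in\Phi}L_{\phi(X)}(\rho)$ in place of $L_{\hat W}(\rho)$. Each inequality is asserted except where its exponent is the undefined expression $\infty+(-\infty)$, that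 is, where the information measure is $\infty$ and the small-ball probability is $0$. -/

import Mathlib

open MeasureTheory ProbabilityTheory
open scoped ENNReal NNReal

noncomputable section

namespace BayesLowerBound

/-- Rényi's divergence `D_α(P‖Q) = (α - 1)⁻¹ log ∫ p ^ α q ^ (1 - α) dμ` of order `α ≠ 1`, where
`p`, `q` are the densities of `P`, `Q` with respect to the dominating measure `μ = P + Q`.
The integrand is `[0, ∞]`-valued: for `α > 1` it is `∞` where `q = 0 < p`. -/
def renyiDiv {Ω : Type*} [MeasurableSpace Ω] (α : ℝ) (P Q : Measure Ω) : EReal :=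
  (((α - 1)⁻¹ : ℝ) : EReal) *
    ENNReal.log (∫⁻ x, P.rnDeriv (P + Q) x ^ α * Q.rnDeriv (P + Q) x ^ (1 - α) ∂(P + Q))

/-- Sibson's mutual information `I_α(A, B) = inf_Q D_α(P_{AB} ‖ P_A ⊗ Q)` of order `α`, where `J`
is the joint law of `(A, B)` and `Q` ranges over the probability measures on the second space. -/
def sibsonMI {𝒜 ℬ : Type*} [MeasurableSpace 𝒜] [MeasurableSpace ℬ] (α : ℝ)
    (J : Measure (𝒜 × ℬ)) : EReal :=
  ⨅ (Q : Measure ℬ) (_ : IsProbabilityMeasure Q), renyiDiv α J (J.fst.prod Q)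

/-- The maximal leakage from `A` to `B`, where `J` is the joint law of `(A, B)`:
the supremum of `log (ℙ(U = Û) / max_u ℙ(U = u))` over all Markov chains `U - A - B - Û` with
`U` and `Û` in a common finite alphabet. Such a chain is given by a channel `κ` that produces `U`
from `A` and a channel `η` that produces `Û` from `B`; then `(κ ∥ₖ η) ∘ₘ J` is the law of
`(U, Û)` and `κ ∘ₘ J.fst` is the law of `U`. -/
def maximalLeakage {𝒜 ℬ : Type*} [MeasurableSpace 𝒜] [MeasurableSpace ℬ]
    (J : Measure (𝒜 × ℬ)) : EReal :=
  ⨆ (n : ℕ) (κ : Kernel 𝒜 (Fin n)) (η : Kernel ℬ (Fin n))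
    (_ : IsMarkovKernel κ) (_ : IsMarkovKernel η),
    ENNReal.log (((κ ∥ₖ η) ∘ₘ J) {p | p.1 = p.2} / ⨆ u : Fin n, (κ ∘ₘ J.fst) {u})

section Framework

variable {𝒲 𝒳 𝒱 : Type*} [MeasurableSpace 𝒲] [MeasurableSpace 𝒳] [MeasurableSpace 𝒱]

/-- The joint law of `(X, W)` when `W ∼ π` and `X ∼ P w` given `W = w`. -/
def jointXW (π : Measure 𝒲) (P : Kernel 𝒲 𝒳) : Measure (𝒳 × 𝒲) :=
  (π ⊗ₘ P).map Prod.swap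

/-- The law of the estimate `Ŵ = φ(X)`. -/
def estimateLaw (π : Measure 𝒲) (P : Kernel 𝒲 𝒳) (φ : 𝒳 → 𝒱) : Measure 𝒱 :=
  (P ∘ₘ π).map φ

/-- The expected loss `𝔼 ℓ(W, φ(X))` of the estimator `φ`. -/
def estimatorRisk (π : Measure 𝒲) (P : Kernel 𝒲 𝒳) (l : 𝒲 → 𝒱 → ℝ≥0) (φ : 𝒳 → 𝒱) : ℝ≥0∞ :=
  ∫⁻ p, (l p.1 (φ p.2) : ℝ≥0∞) ∂(π ⊗ₘ P)

/-- The Bayesian risk: the infimum of the expected loss over all (measurable) estimators. -/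
def bayesianRisk (π : Measure 𝒲) (P : Kernel 𝒲 𝒳) (l : 𝒲 → 𝒱 → ℝ≥0) : ℝ≥0∞ :=
  ⨅ φ : {φ : 𝒳 → 𝒱 // Measurable φ}, estimatorRisk π P l φ.1

/-- The small-ball probability `sup_w ℙ(ℓ(w, Ŵ) < ρ)` of the estimate `Ŵ = φ(X)`. -/
def smallBallEst (π : Measure 𝒲) (P : Kernel 𝒲 𝒳) (l : 𝒲 → 𝒱 → ℝ≥0) (φ : 𝒳 → 𝒱) (ρ : ℝ) :
    ℝ≥0∞ :=
  ⨆ w : 𝒲, estimateLaw π P φ {v | (l w v : ℝ) < ρ}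

/-- The largest small-ball probability of an estimate, over a class `Φ` of estimators. -/
def smallBallClass (π : Measure 𝒲) (P : Kernel 𝒲 𝒳) (l : 𝒲 → 𝒱 → ℝ≥0) (Φ : Set (𝒳 → 𝒱))
    (ρ : ℝ) : ℝ≥0∞ :=
  ⨆ φ ∈ Φ, smallBallEst π P l φ ρ

end Framework

/-- The extended real `ρ (1 - exp (c (I + log L)))`, with `log 0 = -∞`, `exp (-∞) = 0`,
`exp ∞ = ∞`. It is meaningful unless `I = ∞` and `L = 0`. -/
def lowerBound (ρ c : ℝ) (I : EReal) (L : ℝ≥0∞) : EReal :=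
  (ρ : EReal) * (1 - ((EReal.exp ((c : EReal) * (I + ENNReal.log L)) : ℝ≥0∞) : EReal))

end BayesLowerBound

end

/-! By Markov's inequality `ρ ≤ R(φ) + ρ · ℙ(ℓ(W, φ(X)) < ρ)`, so it is enough to bound the joint
law `J` of `(X, W)` on a measurable set `E` by the largest mass `L` that the law of `X` gives to a
section `{x | (x, w) ∈ E}`. Every product `P_X ⊗ Q` gives `E` mass at most `L`, and Hölder's
inequality turns this into `J E ≤ (exp (I_α) · L) ^ ((α - 1) / α)`.

For the maximal leakage, suppose first that `E` has only finitely many distinct sections. Let `U`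
be a section drawn in such a way that each section containing `X` has the same probability `c`,
and let `Û` be the section over `W`. Then `ℙ(U = Û) = c · J E`, while no letter has probability
more than `c · L` once the remaining mass is spread thinly over additional letters. Hence
`J E ≤ exp (ℒ) · L`. Sets with finitely many sections form a ring that generates the product
`σ`-algebra, so an arbitrary `E` can be approximated by them. -/

namespace BayesLowerBound

section Renyi

variable {Ω 𝒜 ℬ : Type*} [MeasurableSpace Ω] [MeasurableSpace 𝒜] [MeasurableSpace ℬ] {α : ℝ}

lemma exp_renyiDiv (α : ℝ) (P Q : Measure Ω) :
    EReal.exp (renyiDiv α P Q) =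
      (∫⁻ x, P.rnDeriv (P + Q) x ^ α * Q.rnDeriv (P + Q) x ^ (1 - α) ∂(P + Q)) ^ (α - 1)⁻¹ := by
  rw [ENNReal.rpow_eq_exp_mul_log, renyiDiv]

lemma eq_rpow_mul_rpow_of_ne_top (hα : 1 < α) {p q : ℝ≥0∞} (hq : q ≠ ∞)
    (h : p ^ α * q ^ (1 - α) ≠ ∞) :
    p = (p ^ α * q ^ (1 - α)) ^ α⁻¹ * q ^ ((α - 1) / α) := by
  have hα₀ : 0 < α := by linarith
  rcases eq_or_ne p 0 with rfl | hp
  · simp [hα₀]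
  have hq₀ : q ≠ 0 := by
    rintro rfl
    exact h (by simp [ENNReal.zero_rpow_of_neg (sub_neg.2 hα), hp, hα₀.le])
  have hexp : (1 - α) * α⁻¹ + (α - 1) / α = 0 := by ring
  rw [ENNReal.mul_rpow_of_nonneg _ _ (by positivity), ← ENNReal.rpow_mul, ← ENNReal.rpow_mul,
    mul_assoc, ← ENNReal.rpow_add _ _ hq₀ hq, hexp, mul_inv_cancel₀ hα₀.ne',
    ENNReal.rpow_one, ENNReal.rpow_zero, mul_one]

lemma lintegral_le_rpow_mul_rpow (hα : 1 < α) {m : Measure Ω} {p q : Ω → ℝ≥0∞}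
    (hp : AEMeasurable p m) (hq : AEMeasurable q m) (hq_top : ∀ᵐ x ∂m, q x ≠ ∞)
    (h : ∫⁻ x, p x ^ α * q x ^ (1 - α) ∂m ≠ ∞) :
    ∫⁻ x, p x ∂m ≤
      (∫⁻ x, p x ^ α * q x ^ (1 - α) ∂m) ^ α⁻¹ * (∫⁻ x, q x ∂m) ^ ((α - 1) / α) := by
  have hα₀ : 0 < α := by linarith
  have hα₁ : 0 < α - 1 := by linarith
  have hconj : α.HolderConjugate (α / (α - 1)) := Real.HolderConjugate.conjExponent hα
  calc ∫⁻ x, p x ∂m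
      = ∫⁻ x, (p x ^ α * q x ^ (1 - α)) ^ α⁻¹ * q x ^ ((α - 1) / α) ∂m := by
        refine lintegral_congr_ae ?_
        filter_upwards [ae_lt_top' (by fun_prop) h, hq_top] with x hx hqx
        exact eq_rpow_mul_rpow_of_ne_top hα hqx hx.ne
    _ ≤ (∫⁻ x, ((p x ^ α * q x ^ (1 - α)) ^ α⁻¹) ^ α ∂m) ^ (1 / α) *
          (∫⁻ x, (q x ^ ((α - 1) / α)) ^ (α / (α - 1)) ∂m) ^ (1 / (α / (α - 1))) :=
        ENNReal.lintegral_mul_le_Lp_mul_Lq _ hconj (by fun_prop) (by fun_prop)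
    _ = (∫⁻ x, p x ^ α * q x ^ (1 - α) ∂m) ^ α⁻¹ * (∫⁻ x, q x ∂m) ^ ((α - 1) / α) := by
        have hexp : (α - 1) / α * (α / (α - 1)) = 1 := by field_simp
        simp_rw [← ENNReal.rpow_mul, inv_mul_cancel₀ hα₀.ne', hexp, ENNReal.rpow_one, one_div,
          inv_div]

lemma measure_le_exp_renyiDiv_mul_rpow (hα : 1 < α) (P Q : Measure Ω) [SigmaFinite P]
    [SigmaFinite Q] (E : Set Ω) (h : renyiDiv α P Q ≠ ⊤) :
    P E ≤ (EReal.exp (renyiDiv α P Q) * Q E) ^ ((α - 1) / α) := by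
  have hα₁ : 0 < α - 1 := by linarith
  have hP : P ≪ P + Q := (Measure.le_add_right le_rfl).absolutelyContinuous
  have hQ : Q ≪ P + Q := (Measure.le_add_left le_rfl).absolutelyContinuous
  have hexp : (α - 1)⁻¹ * ((α - 1) / α) = α⁻¹ := by field_simp
  rw [ENNReal.mul_rpow_of_nonneg _ _ (by positivity), exp_renyiDiv, ← ENNReal.rpow_mul, hexp]
  have hint : ∫⁻ x, P.rnDeriv (P + Q) x ^ α * Q.rnDeriv (P + Q) x ^ (1 - α) ∂(P + Q) ≠ ∞ := by
    rw [ne_eq, ← EReal.exp_eq_top_iff, exp_renyiDiv] at h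
    exact fun h_top => h (by rw [h_top, ENNReal.top_rpow_of_pos (by positivity)])
  have hint_E := setLIntegral_le_lintegral (μ := P + Q) E
    fun x => P.rnDeriv (P + Q) x ^ α * Q.rnDeriv (P + Q) x ^ (1 - α)
  rw [← Measure.setLIntegral_rnDeriv hP E, ← Measure.setLIntegral_rnDeriv hQ E]
  refine (lintegral_le_rpow_mul_rpow hα (by fun_prop) (by fun_prop)
    (ae_restrict_of_ae (Measure.rnDeriv_ne_top Q (P + Q)))
    (ne_top_of_le_ne_top hint hint_E)).trans ?_
  gcongr

lemma prod_le_iSup_section (μ : Measure 𝒜) (ν : Measure ℬ) [SFinite μ] [IsProbabilityMeasure ν]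
    {E : Set (𝒜 × ℬ)} (hE : MeasurableSet E) :
    μ.prod ν E ≤ ⨆ b, μ ((fun a => (a, b)) ⁻¹' E) := by
  rw [Measure.prod_apply_symm hE]
  exact (lintegral_mono fun b => le_iSup (fun b => μ ((fun a => (a, b)) ⁻¹' E)) b).trans
    (by simp)

theorem measure_le_exp_sibsonMI_mul_rpow (hα : 1 < α) (J : Measure (𝒜 × ℬ)) [IsFiniteMeasure J]
    {E : Set (𝒜 × ℬ)} (hE : MeasurableSet E)
    (h : sibsonMI α J ≠ ⊤ ∨ ⨆ b, J.fst ((fun a => (a, b)) ⁻¹' E) ≠ 0) :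
    J E ≤ (EReal.exp (sibsonMI α J) * ⨆ b, J.fst ((fun a => (a, b)) ⁻¹' E)) ^ ((α - 1) / α) := by
  have hc : 0 < (α - 1) / α := div_pos (by linarith) (by linarith)
  rw [← ENNReal.rpow_inv_le_iff hc]
  refine ENNReal.le_mul_of_forall_lt (.inr ?_) (h.imp_left (by simp)) fun M hM L hL => ?_
  · exact ne_top_of_le_ne_top (measure_ne_top J.fst Set.univ)
      (iSup_le fun b => measure_mono (Set.subset_univ _))
  obtain ⟨Q, hQ, hQM⟩ : ∃ Q : Measure ℬ, ∃ _ : IsProbabilityMeasure Q,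
      EReal.exp (renyiDiv α J (J.fst.prod Q)) < M := by
    simpa only [sibsonMI, ← EReal.expOrderIso_apply, OrderIso.map_iInf, gt_iff_lt,
      iInf_lt_iff] using hM
  have hQ_top : renyiDiv α J (J.fst.prod Q) ≠ ⊤ := by
    simpa using hQM.ne_top
  calc J E ^ ((α - 1) / α)⁻¹
      ≤ EReal.exp (renyiDiv α J (J.fst.prod Q)) * J.fst.prod Q E :=
        (ENNReal.rpow_inv_le_iff hc).2 (measure_le_exp_renyiDiv_mul_rpow hα J _ E hQ_top)
    _ ≤ M * L := mul_le_mul' hQM.le ((prod_le_iSup_section _ _ hE).trans hL.le)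

end Renyi

section Leakage

variable {𝒜 ℬ : Type*} [MeasurableSpace 𝒜] [MeasurableSpace ℬ]

/-- The channel from `𝒜` to the alphabet `Fin n` with transition probabilities `g a i`. Encoded
with a density against the counting measure, it is the zero kernel if `g` is not measurable. -/
noncomputable def finiteChannel {n : ℕ} (g : 𝒜 → Fin n → ℝ≥0∞) : Kernel 𝒜 (Fin n) :=
  Kernel.withDensity (Kernel.const 𝒜 Measure.count) g

section FiniteChannel

variable {n : ℕ} {g : 𝒜 → Fin n → ℝ≥0∞}

lemma finiteChannel_apply (hg : Measurable g) (a : 𝒜) (s : Set (Fin n)) :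
    finiteChannel g a s = ∫⁻ i in s, g a i ∂Measure.count := by
  have hg' : Measurable (Function.uncurry g) :=
    measurable_from_prod_countable_left fun i => (measurable_pi_apply i).comp hg
  rw [finiteChannel, Kernel.withDensity_apply' _ hg', Kernel.const_apply]

lemma finiteChannel_apply_singleton (hg : Measurable g) (a : 𝒜) (i : Fin n) :
    finiteChannel g a {i} = g a i := by
  simp [finiteChannel_apply hg]

lemma isMarkovKernel_finiteChannel (hg : Measurable g) (hg_sum : ∀ a, ∑ i, g a i = 1) :
    IsMarkovKernel (finiteChannel g) :=
  ⟨fun a => ⟨by simp [finiteChannel_apply hg, lintegral_fintype, hg_sum]⟩⟩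

end FiniteChannel

lemma iSup_measure_singleton_ne_zero {ι : Type*} [Countable ι] [MeasurableSpace ι] (μ : Measure ι)
    [NeZero μ] : ⨆ i, μ {i} ≠ 0 := by
  intro h
  refine NeZero.ne μ (Measure.measure_univ_eq_zero.1 ?_)
  rw [← Set.iUnion_of_singleton, measure_iUnion_null_iff]
  simpa using h

lemma lintegral_kernel_singleton_le_exp_maximalLeakage_mul (J : Measure (𝒜 × ℬ))
    [IsProbabilityMeasure J] {n : ℕ} (κ : Kernel 𝒜 (Fin n)) [IsMarkovKernel κ] {f : ℬ → Fin n}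
    (hf : Measurable f) :
    ∫⁻ p, κ p.1 {f p.2} ∂J ≤ EReal.exp (maximalLeakage J) * ⨆ u, (κ ∘ₘ J.fst) {u} := by
  have hsup : ⨆ u, (κ ∘ₘ J.fst) {u} ≠ ∞ :=
    ne_top_of_le_ne_top ENNReal.one_ne_top (iSup_le fun _ => prob_le_one)
  have hguess : ((κ ∥ₖ Kernel.deterministic f hf) ∘ₘ J) {p | p.1 = p.2} =
      ∫⁻ p, κ p.1 {f p.2} ∂J := by
    rw [Measure.bind_apply (Set.toFinite _).measurableSet (Kernel.aemeasurable _)]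
    refine lintegral_congr fun p => ?_
    rw [Kernel.parallelComp_apply, Kernel.deterministic_apply,
      Measure.prod_apply_symm (Set.toFinite _).measurableSet, lintegral_dirac]
    rfl
  rw [← ENNReal.div_le_iff (iSup_measure_singleton_ne_zero _) hsup, ← ENNReal.exp_log (_ / _),
    EReal.exp_le_exp_iff, ← hguess]
  exact le_iSup_of_le n (le_iSup₂_of_le κ (Kernel.deterministic f hf)
    (le_iSup₂_of_le inferInstance inferInstance le_rfl))

/-- The missing mass `1 - ∑ i, g a i` is spread over so many additional letters that none of them
is more likely than `ε`. -/
lemma lintegral_le_exp_maximalLeakage_mul_of_sum_le_one (J : Measure (𝒜 × ℬ))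
    [IsProbabilityMeasure J] {n : ℕ} {g : 𝒜 → Fin n → ℝ≥0∞} (hg : Measurable g)
    (hg_sum : ∀ a, ∑ i, g a i ≤ 1) {ε : ℝ≥0∞} (hε : ε ≠ 0) (hgε : ∀ i, ∫⁻ a, g a i ∂J.fst ≤ ε)
    {f : ℬ → Fin n} (hf : Measurable f) :
    ∫⁻ p, g p.1 (f p.2) ∂J ≤ EReal.exp (maximalLeakage J) * ε := by
  obtain ⟨N, hNε⟩ := ENNReal.exists_inv_nat_lt hε
  have hN : (N : ℝ≥0∞) ≠ 0 := fun h => by simp [h] at hNε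
  have hg_apply : ∀ i, Measurable fun a => g a i := fun i => (measurable_pi_apply i).comp hg
  let rest : 𝒜 → Fin N → ℝ≥0∞ := fun a _ => (1 - ∑ i, g a i) / N
  let g' : 𝒜 → Fin (n + N) → ℝ≥0∞ := fun a => Fin.append (g a) (rest a)
  have hg' : Measurable g' := measurable_pi_iff.2 fun i => by
    induction i using Fin.addCases with
    | left i => simpa [g'] using hg_apply i
    | right j => simp only [g', Fin.append_right, rest]; fun_prop
  have hg'_sum : ∀ a, ∑ i, g' a i = 1 := fun a => by
    simp [g', rest, Fin.sum_univ_add, ENNReal.mul_div_cancel hN, hg_sum a]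
  have := isMarkovKernel_finiteChannel hg' hg'_sum
  have hg'ε : ∀ i, (finiteChannel g' ∘ₘ J.fst) {i} ≤ ε := fun i => by
    rw [Measure.bind_apply (measurableSet_singleton i) (Kernel.aemeasurable _)]
    simp only [finiteChannel_apply_singleton hg']
    induction i using Fin.addCases with
    | left i => simpa [g'] using hgε i
    | right j =>
      calc ∫⁻ a, g' a (Fin.natAdd n j) ∂J.fst ≤ ∫⁻ _, (N : ℝ≥0∞)⁻¹ ∂J.fst :=
            lintegral_mono fun a => by
              simp only [g', rest, Fin.append_right, ENNReal.div_eq_inv_mul]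
              exact mul_le_of_le_one_right' tsub_le_self
        _ ≤ ε := by simpa using hNε.le
  calc ∫⁻ p, g p.1 (f p.2) ∂J
      = ∫⁻ p, finiteChannel g' p.1 {Fin.castAdd N (f p.2)} ∂J := by
        simp [finiteChannel_apply_singleton hg', g']
    _ ≤ EReal.exp (maximalLeakage J) * ⨆ i, (finiteChannel g' ∘ₘ J.fst) {i} :=
        lintegral_kernel_singleton_le_exp_maximalLeakage_mul J _ (measurable_from_top.comp hf)
    _ ≤ EReal.exp (maximalLeakage J) * ε := by gcongr; exact iSup_le hg'ε

lemma measurableSet_setOf_mem_simpleFunc {s : SimpleFunc ℬ (Set 𝒜)}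
    (hs : ∀ b, MeasurableSet (s b)) : MeasurableSet {p : 𝒜 × ℬ | p.1 ∈ s p.2} := by
  have h_eq : {p : 𝒜 × ℬ | p.1 ∈ s p.2} = ⋃ A ∈ s.range, A ×ˢ (s ⁻¹' {A}) := by
    ext p
    simp only [Set.mem_ofPred_eq, Set.mem_iUnion, Set.mem_prod, Set.mem_preimage,
      Set.mem_singleton_iff, exists_prop]
    exact ⟨fun h => ⟨s p.2, s.mem_range_self _, h, rfl⟩, fun ⟨_, _, h, hs⟩ => hs ▸ h⟩
  rw [h_eq]
  refine Finset.measurableSet_biUnion _ fun A hA => ?_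
  obtain ⟨b, rfl⟩ := SimpleFunc.mem_range.1 hA
  exact (hs b).prod (s.measurableSet_fiber _)

/-- The letters are the sections of the set; given `a`, each section that contains `a` is drawn
with one and the same small probability, and `b` guesses its own section. -/
lemma measure_setOf_mem_simpleFunc_le (J : Measure (𝒜 × ℬ)) [IsProbabilityMeasure J]
    {s : SimpleFunc ℬ (Set 𝒜)} (hs : ∀ b, MeasurableSet (s b)) {L : ℝ≥0∞} (hL : L ≠ 0)
    (hsL : ∀ b, J.fst (s b) ≤ L) :
    J {p | p.1 ∈ s p.2} ≤ EReal.exp (maximalLeakage J) * L := by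
  classical
  let n := s.range.card
  let e : s.range ≃ Fin n := s.range.equivFin
  let f : ℬ → Fin n := fun b => e ⟨s b, s.mem_range_self b⟩
  have hf : Measurable f := measurable_to_countable' fun i => by
    convert s.measurableSet_fiber (e.symm i : Set 𝒜) using 1
    ext b
    simp [f, ← Equiv.eq_symm_apply, Subtype.ext_iff]
  let c : ℝ≥0∞ := ((n + 1 : ℕ) : ℝ≥0∞)⁻¹
  have hc : c ≠ 0 := by simp [c]
  have hc_top : c ≠ ∞ := by simp [c]
  have hsection : ∀ i, MeasurableSet (e.symm i : Set 𝒜) ∧ J.fst (e.symm i : Set 𝒜) ≤ L := by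
    intro i
    obtain ⟨b, hb⟩ := SimpleFunc.mem_range.1 (e.symm i).2
    exact hb ▸ ⟨hs b, hsL b⟩
  let g : 𝒜 → Fin n → ℝ≥0∞ := fun a i => (e.symm i : Set 𝒜).indicator (fun _ => c) a
  have hg : Measurable g :=
    measurable_pi_iff.2 fun i => measurable_const.indicator (hsection i).1
  have hg_sum : ∀ a, ∑ i, g a i ≤ 1 := fun a =>
    calc ∑ i, g a i ≤ ∑ _i : Fin n, c :=
          Finset.sum_le_sum fun i _ => Set.indicator_le_self' (fun _ _ => zero_le) a
      _ = n / (n + 1 : ℕ) := by simp [c, div_eq_mul_inv]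
      _ ≤ 1 := ENNReal.div_le_of_le_mul (by simp)
  have hgL : ∀ i, ∫⁻ a, g a i ∂J.fst ≤ c * L := fun i => by
    simp only [g, lintegral_indicator_const (hsection i).1]
    gcongr
    exact (hsection i).2
  rw [← ENNReal.mul_le_mul_iff_right hc hc_top]
  calc c * J {p | p.1 ∈ s p.2}
      = ∫⁻ p, g p.1 (f p.2) ∂J := by
        rw [← lintegral_indicator_const (measurableSet_setOf_mem_simpleFunc hs)]
        simp [g, f, Set.indicator_apply]
    _ ≤ EReal.exp (maximalLeakage J) * (c * L) :=
        lintegral_le_exp_maximalLeakage_mul_of_sum_le_one J hg hg_sum (mul_ne_zero hc hL) hgL hf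
    _ = c * (EReal.exp (maximalLeakage J) * L) := mul_left_comm _ _ _

/-- The measurable sets of a product with finitely many distinct sections `{a | (a, b) ∈ T}`, each
occurring over a measurable set of points `b`. They are encoded by the simple function that sends
`b` to the section over `b`. -/
def finiteSectionSets (𝒜 ℬ : Type*) [MeasurableSpace 𝒜] [MeasurableSpace ℬ] : Set (Set (𝒜 × ℬ)) :=
  {T | ∃ s : SimpleFunc ℬ (Set 𝒜), (∀ b, MeasurableSet (s b)) ∧ {p | p.1 ∈ s p.2} = T}

lemma prod_mem_finiteSectionSets {A : Set 𝒜} {B : Set ℬ} (hA : MeasurableSet A)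
    (hB : MeasurableSet B) : A ×ˢ B ∈ finiteSectionSets 𝒜 ℬ := by
  classical
  refine ⟨SimpleFunc.piecewise B hB (SimpleFunc.const _ A) (SimpleFunc.const _ ∅), ?_, ?_⟩
  · intro b
    by_cases hb : b ∈ B <;> simp [hb, hA]
  · ext p
    by_cases hp : p.2 ∈ B <;> simp [hp]

lemma isSetRing_finiteSectionSets : IsSetRing (finiteSectionSets 𝒜 ℬ) where
  empty_mem := ⟨SimpleFunc.const _ ∅, by simp, by simp⟩
  union_mem := by
    rintro _ _ ⟨s, hs, rfl⟩ ⟨t, ht, rfl⟩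
    exact ⟨(s.pair t).map fun A : Set 𝒜 × Set 𝒜 => A.1 ∪ A.2, fun b => (hs b).union (ht b), rfl⟩
  sdiff_mem := by
    rintro _ _ ⟨s, hs, rfl⟩ ⟨t, ht, rfl⟩
    exact ⟨(s.pair t).map fun A : Set 𝒜 × Set 𝒜 => A.1 \ A.2, fun b => (hs b).diff (ht b), rfl⟩

lemma generateFrom_finiteSectionSets :
    MeasurableSpace.generateFrom (finiteSectionSets 𝒜 ℬ) = Prod.instMeasurableSpace := by
  refine le_antisymm (MeasurableSpace.generateFrom_le ?_) ?_
  · rintro _ ⟨s, hs, rfl⟩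
    exact measurableSet_setOf_mem_simpleFunc hs
  · rw [← generateFrom_prod]
    refine MeasurableSpace.generateFrom_mono ?_
    rintro _ ⟨A, hA, B, hB, rfl⟩
    exact prod_mem_finiteSectionSets hA hB

lemma exists_simpleFunc_measure_symmDiff_lt (m : Measure (𝒜 × ℬ)) [IsFiniteMeasure m]
    {E : Set (𝒜 × ℬ)} (hE : MeasurableSet E) {ε : ℝ≥0∞} (hε : 0 < ε) :
    ∃ s : SimpleFunc ℬ (Set 𝒜), (∀ b, MeasurableSet (s b)) ∧
      m (symmDiff {p | p.1 ∈ s p.2} E) < ε := by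
  have huniv : Set.univ ∈ finiteSectionSets 𝒜 ℬ := by
    simpa using prod_mem_finiteSectionSets (𝒜 := 𝒜) (ℬ := ℬ) .univ .univ
  obtain ⟨_, ⟨s, hs, rfl⟩, hsE⟩ := exists_measure_symmDiff_lt_of_generateFrom_isSetRing (μ := m)
    isSetRing_finiteSectionSets ⟨{Set.univ}, Set.countable_singleton _, by simpa using huniv,
      by simp⟩ generateFrom_finiteSectionSets.symm hE hε
  exact ⟨s, hs, hsE⟩

/-- If every section of `E` has mass at most `L`, then a section of mass more than `L + r` exceeds
the corresponding section of `E` by more than `r`. -/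
lemma mul_measure_lt_measure_section_le (μ : Measure 𝒜) (ν : Measure ℬ) [SFinite μ] [SFinite ν]
    {T E : Set (𝒜 × ℬ)} (hT : MeasurableSet T) (hE : MeasurableSet E) {L : ℝ≥0∞}
    (hEL : ∀ b, μ ((fun a => (a, b)) ⁻¹' E) ≤ L) (r : ℝ≥0∞) :
    r * ν {b | L + r < μ ((fun a => (a, b)) ⁻¹' T)} ≤ μ.prod ν (T \ E) := by
  rw [Measure.prod_apply_symm (hT.diff hE)]
  refine le_trans ?_ (mul_meas_ge_le_lintegral (measurable_measure_prodMk_right (hT.diff hE)) r)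
  gcongr with b
  intro hb
  have hsection : μ ((fun a => (a, b)) ⁻¹' T) ≤ L + μ ((fun a => (a, b)) ⁻¹' (T \ E)) :=
    calc μ ((fun a => (a, b)) ⁻¹' T)
        ≤ μ ((fun a => (a, b)) ⁻¹' E) + μ ((fun a => (a, b)) ⁻¹' (T \ E)) := by
          rw [Set.preimage_sdiff]
          exact measure_le_inter_add_sdiff _ _ _ |>.trans (by gcongr; exact Set.inter_subset_right)
      _ ≤ _ := by gcongr; exact hEL b
  exact (lt_of_add_lt_add_left (hb.trans_le hsection)).le

lemma exists_simpleFunc_section_le_eq_of_section_le (μ : Measure 𝒜) {s : SimpleFunc ℬ (Set 𝒜)}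
    (hs : ∀ b, MeasurableSet (s b)) (M : ℝ≥0∞) :
    ∃ t : SimpleFunc ℬ (Set 𝒜), (∀ b, MeasurableSet (t b)) ∧ (∀ b, μ (t b) ≤ M) ∧
      ∀ b, μ (s b) ≤ M → t b = s b := by
  classical
  refine ⟨s.map fun A => if μ A ≤ M then A else ∅, fun b => ?_, fun b => ?_, fun b hb => ?_⟩
  · by_cases hb : μ (s b) ≤ M <;> simp [hb, hs b]
  · by_cases hb : μ (s b) ≤ M <;> simp [hb]
  · simp [hb]

lemma exists_simpleFunc_section_le_measure_sdiff_le (J : Measure (𝒜 × ℬ)) [IsFiniteMeasure J]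
    (μ : Measure 𝒜) [IsFiniteMeasure μ] {E : Set (𝒜 × ℬ)} (hE : MeasurableSet E) {L L' : ℝ≥0∞}
    (hEL : ∀ b, μ ((fun a => (a, b)) ⁻¹' E) ≤ L) (hL : L < L') {ε : ℝ≥0∞} (hε : ε ≠ 0) :
    ∃ s : SimpleFunc ℬ (Set 𝒜), (∀ b, MeasurableSet (s b)) ∧ (∀ b, μ (s b) ≤ L') ∧
      J (E \ {p | p.1 ∈ s p.2}) ≤ ε := by
  obtain ⟨r, hr, hrL⟩ := ENNReal.lt_iff_exists_add_pos_lt.1 hL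
  have hr₀ : (r : ℝ≥0∞) ≠ 0 := by simpa using hr.ne'
  obtain ⟨s, hs, hsE⟩ := exists_simpleFunc_measure_symmDiff_lt (J + μ.prod J.snd) hE
    (ε := min (ε / 2) (r * (ε / 2))) (by simp [pos_iff_ne_zero, hε, hr₀])
  let T : Set (𝒜 × ℬ) := {p | p.1 ∈ s p.2}
  let heavy : Set ℬ := {b | L + r < μ (s b)}
  have hT : MeasurableSet T := measurableSet_setOf_mem_simpleFunc hs
  have hE_sdiff_T : J (E \ T) ≤ ε / 2 :=
    calc J (E \ T) ≤ J (symmDiff T E) := measure_mono Set.subset_union_right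
      _ ≤ (J + μ.prod J.snd) (symmDiff T E) := by rw [Measure.add_apply]; exact le_self_add
      _ ≤ ε / 2 := hsE.le.trans (min_le_left _ _)
  have hheavy : J.snd heavy ≤ ε / 2 := by
    rw [← ENNReal.mul_le_mul_iff_right hr₀ ENNReal.coe_ne_top]
    calc r * J.snd heavy ≤ μ.prod J.snd (T \ E) :=
          mul_measure_lt_measure_section_le μ J.snd hT hE hEL r
      _ ≤ μ.prod J.snd (symmDiff T E) := measure_mono Set.subset_union_left
      _ ≤ (J + μ.prod J.snd) (symmDiff T E) := by rw [Measure.add_apply]; exact le_add_self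
      _ ≤ r * (ε / 2) := hsE.le.trans (min_le_right _ _)
  have hheavy_meas : MeasurableSet heavy := s.measurableSet_preimage {A | L + r < μ A}
  obtain ⟨t, ht, htL, hts⟩ := exists_simpleFunc_section_le_eq_of_section_le μ hs (L + r)
  have hE_sdiff_t : E \ {p | p.1 ∈ t p.2} ⊆ E \ T ∪ Prod.snd ⁻¹' heavy := fun p hp =>
    or_iff_not_imp_right.2 fun hb => ⟨hp.1, fun hpT => hp.2 ((hts p.2 (not_lt.1 hb)).ge hpT)⟩
  refine ⟨t, ht, fun b => (htL b).trans hrL.le, ?_⟩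
  calc J (E \ {p | p.1 ∈ t p.2}) ≤ J (E \ T) + J.snd heavy := by
        rw [Measure.snd_apply hheavy_meas]
        exact (measure_mono hE_sdiff_t).trans (measure_union_le _ _)
    _ ≤ ε := (add_le_add hE_sdiff_T hheavy).trans_eq (ENNReal.add_halves ε)

theorem measure_le_exp_maximalLeakage_mul (J : Measure (𝒜 × ℬ)) [IsProbabilityMeasure J]
    {E : Set (𝒜 × ℬ)} (hE : MeasurableSet E)
    (h : maximalLeakage J ≠ ⊤ ∨ ⨆ b, J.fst ((fun a => (a, b)) ⁻¹' E) ≠ 0) :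
    J E ≤ EReal.exp (maximalLeakage J) * ⨆ b, J.fst ((fun a => (a, b)) ⁻¹' E) := by
  refine ENNReal.le_mul_of_forall_lt (.inr ?_) (h.imp_left (by simp)) fun M hM L hL => ?_
  · exact ne_top_of_le_ne_top ENNReal.one_ne_top (iSup_le fun _ => prob_le_one)
  refine ENNReal.le_of_forall_pos_le_add fun ε hε _ => ?_
  obtain ⟨s, hs, hsL, hsE⟩ := exists_simpleFunc_section_le_measure_sdiff_le J J.fst hE
    (le_iSup fun b => J.fst ((fun a => (a, b)) ⁻¹' E)) hL (ε := ε) (by simpa using hε.ne')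
  calc J E ≤ J {p | p.1 ∈ s p.2} + J (E \ {p | p.1 ∈ s p.2}) :=
        (measure_le_inter_add_sdiff _ _ _).trans (by gcongr; exact Set.inter_subset_right)
    _ ≤ EReal.exp (maximalLeakage J) * L + ε :=
        add_le_add (measure_setOf_mem_simpleFunc_le J hs (zero_le.trans_lt hL).ne' hsL) hsE
    _ ≤ M * L + ε := by gcongr

end Leakage

section LowerBound

variable {ρ c : ℝ} {I : EReal} {L R : ℝ≥0∞}

lemma exp_mul_add_log (c : ℝ) (I : EReal) (L : ℝ≥0∞) :
    EReal.exp (c * (I + ENNReal.log L)) = (EReal.exp I * L) ^ c := by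
  rw [mul_comm, EReal.exp_mul, EReal.exp_add, ENNReal.exp_log]

lemma lowerBound_le_coe_of_le_add (hρ : 0 < ρ)
    (h : ENNReal.ofReal ρ ≤ R + ENNReal.ofReal ρ * (EReal.exp I * L) ^ c) :
    lowerBound ρ c I L ≤ R := by
  rw [lowerBound, exp_mul_add_log]
  generalize (EReal.exp I * L) ^ c = e at h
  induction e with
  | top => simp [EReal.coe_mul_bot_of_pos hρ]
  | coe e =>
    induction R with
    | top => simp
    | coe R =>
      have h_real : ρ ≤ R + ρ * e := by
        have := ENNReal.toReal_mono (by finiteness) h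
        rwa [ENNReal.toReal_add (by finiteness) (by finiteness), ENNReal.toReal_mul,
          ENNReal.toReal_ofReal hρ.le] at this
      have h_ereal : ((ρ * (1 - e) : ℝ) : EReal) ≤ (R : ℝ) := by
        rw [EReal.coe_le_coe_iff]
        linarith
      simpa [EReal.coe_nnreal_eq_coe_real] using h_ereal

lemma lowerBound_top (hρ : 0 < ρ) (hc : 0 < c) (hL : L ≠ 0) : lowerBound ρ c ⊤ L = ⊥ := by
  have h_top : (⊤ : EReal) + ENNReal.log L = ⊤ := EReal.top_add_of_ne_bot (by simpa using hL)
  simp [lowerBound, h_top, EReal.coe_mul_top_of_pos hc, EReal.coe_mul_bot_of_pos hρ]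

lemma lowerBound_antitone (hρ : 0 ≤ ρ) (hc : 0 ≤ c) (I : EReal) :
    Antitone (lowerBound ρ c I) := by
  intro L L' hL
  rw [lowerBound, lowerBound, exp_mul_add_log, exp_mul_add_log]
  refine mul_le_mul_of_nonneg_left (EReal.sub_le_sub le_rfl ?_) (by exact_mod_cast hρ)
  rw [EReal.coe_ennreal_le_coe_ennreal_iff]
  gcongr

end LowerBound

section Risk

lemma mul_measure_univ_le_lintegral_add_mul_measure_lt {Ω : Type*} [MeasurableSpace Ω]
    {μ : Measure Ω} {f : Ω → ℝ≥0∞} (hf : AEMeasurable f μ) (r : ℝ≥0∞) :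
    r * μ Set.univ ≤ ∫⁻ x, f x ∂μ + r * μ {x | f x < r} := by
  have h_univ : Set.univ = {x | r ≤ f x} ∪ {x | f x < r} := by
    ext x
    simpa using le_or_gt r (f x)
  calc r * μ Set.univ ≤ r * (μ {x | r ≤ f x} + μ {x | f x < r}) := by
        rw [h_univ]
        gcongr
        exact measure_union_le _ _
    _ ≤ ∫⁻ x, f x ∂μ + r * μ {x | f x < r} := by
        rw [mul_add]
        gcongr
        exact mul_meas_ge_le_lintegral₀ hf r

variable {𝒲 𝒳 𝒱 : Type*} [MeasurableSpace 𝒲] [MeasurableSpace 𝒳] [MeasurableSpace 𝒱]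
  (π : Measure 𝒲) (P : Kernel 𝒲 𝒳) {l : 𝒲 → 𝒱 → ℝ≥0} {φ : 𝒳 → 𝒱} {ρ c : ℝ} {I : EReal}

instance isProbabilityMeasure_jointXW [IsProbabilityMeasure π] [IsMarkovKernel P] :
    IsProbabilityMeasure (jointXW π P) :=
  Measure.isProbabilityMeasure_map measurable_swap.aemeasurable

lemma measurableSet_loss_lt (hl : Measurable (Function.uncurry l)) (hφ : Measurable φ) (ρ : ℝ) :
    MeasurableSet {p : 𝒳 × 𝒲 | (l p.2 (φ p.1) : ℝ) < ρ} :=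
  measurableSet_lt (hl.comp (measurable_snd.prodMk (hφ.comp measurable_fst))).coe_nnreal_real
    measurable_const

lemma iSup_fst_jointXW_section_eq_smallBallEst [SFinite π] [IsSFiniteKernel P]
    (hl : ∀ w, Measurable (l w)) (hφ : Measurable φ) (ρ : ℝ) :
    ⨆ w, (jointXW π P).fst ((fun x => (x, w)) ⁻¹' {p | (l p.2 (φ p.1) : ℝ) < ρ}) =
      smallBallEst π P l φ ρ := by
  refine iSup_congr fun w => ?_
  rw [jointXW, Measure.fst_map_swap, Measure.snd_compProd, estimateLaw,
    Measure.map_apply hφ (measurableSet_lt (hl w).coe_nnreal_real measurable_const)]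
  rfl

lemma ofReal_le_estimatorRisk_add [IsProbabilityMeasure π] [IsMarkovKernel P]
    (hl : Measurable (Function.uncurry l)) (hφ : Measurable φ) (ρ : ℝ) :
    ENNReal.ofReal ρ ≤ estimatorRisk π P l φ +
      ENNReal.ofReal ρ * jointXW π P {p | (l p.2 (φ p.1) : ℝ) < ρ} := by
  have h_loss : Measurable fun p : 𝒲 × 𝒳 => (l p.1 (φ p.2) : ℝ≥0∞) :=
    (hl.comp (measurable_fst.prodMk (hφ.comp measurable_snd))).coe_nnreal_ennreal
  rw [jointXW, Measure.map_apply measurable_swap (measurableSet_loss_lt hl hφ ρ)]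
  simpa [estimatorRisk, ENNReal.lt_ofReal_iff_toReal_lt] using
    mul_measure_univ_le_lintegral_add_mul_measure_lt (μ := π ⊗ₘ P) h_loss.aemeasurable
      (ENNReal.ofReal ρ)

lemma lowerBound_smallBallEst_le_estimatorRisk [IsProbabilityMeasure π] [IsMarkovKernel P]
    (hl : Measurable (Function.uncurry l)) (hφ : Measurable φ) (hρ : 0 < ρ)
    (h : jointXW π P {p | (l p.2 (φ p.1) : ℝ) < ρ} ≤
      (EReal.exp I * smallBallEst π P l φ ρ) ^ c) :
    lowerBound ρ c I (smallBallEst π P l φ ρ) ≤ estimatorRisk π P l φ :=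
  lowerBound_le_coe_of_le_add hρ <|
    (ofReal_le_estimatorRisk_add π P hl hφ ρ).trans (by gcongr)

theorem lowerBound_sibsonMI_le_estimatorRisk [IsProbabilityMeasure π] [IsMarkovKernel P]
    (hl : Measurable (Function.uncurry l)) (hφ : Measurable φ) (hρ : 0 < ρ) {α : ℝ} (hα : 1 < α)
    (h : sibsonMI α (jointXW π P) ≠ ⊤ ∨ smallBallEst π P l φ ρ ≠ 0) :
    lowerBound ρ ((α - 1) / α) (sibsonMI α (jointXW π P)) (smallBallEst π P l φ ρ) ≤
      estimatorRisk π P l φ := by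
  have h_sup := iSup_fst_jointXW_section_eq_smallBallEst π P
    (fun w => hl.of_uncurry_left (x := w)) hφ ρ
  refine lowerBound_smallBallEst_le_estimatorRisk π P hl hφ hρ ?_
  rw [← h_sup] at h ⊢
  exact measure_le_exp_sibsonMI_mul_rpow hα _ (measurableSet_loss_lt hl hφ ρ) h

theorem lowerBound_maximalLeakage_le_estimatorRisk [IsProbabilityMeasure π] [IsMarkovKernel P]
    (hl : Measurable (Function.uncurry l)) (hφ : Measurable φ) (hρ : 0 < ρ)
    (h : maximalLeakage (jointXW π P) ≠ ⊤ ∨ smallBallEst π P l φ ρ ≠ 0) :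
    lowerBound ρ 1 (maximalLeakage (jointXW π P)) (smallBallEst π P l φ ρ) ≤
      estimatorRisk π P l φ := by
  have h_sup := iSup_fst_jointXW_section_eq_smallBallEst π P
    (fun w => hl.of_uncurry_left (x := w)) hφ ρ
  refine lowerBound_smallBallEst_le_estimatorRisk π P hl hφ hρ ?_
  rw [← h_sup] at h ⊢
  rw [ENNReal.rpow_one]
  exact measure_le_exp_maximalLeakage_mul _ (measurableSet_loss_lt hl hφ ρ) h

lemma lowerBound_smallBallClass_le_iInf_estimatorRisk (hρ : 0 < ρ) (hc : 0 < c)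
    {Φ : Set (𝒳 → 𝒱)} (h : I ≠ ⊤ ∨ smallBallClass π P l Φ ρ ≠ 0)
    (hΦ : ∀ φ ∈ Φ, (I ≠ ⊤ ∨ smallBallEst π P l φ ρ ≠ 0) →
      lowerBound ρ c I (smallBallEst π P l φ ρ) ≤ estimatorRisk π P l φ) :
    lowerBound ρ c I (smallBallClass π P l Φ ρ) ≤ (⨅ φ ∈ Φ, estimatorRisk π P l φ : ℝ≥0∞) := by
  rcases eq_or_ne I ⊤ with rfl | hI
  · rw [lowerBound_top hρ hc (by simpa using h)]
    exact bot_le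
  have h_risk : ∀ φ ∈ Φ, lowerBound ρ c I (smallBallClass π P l Φ ρ) ≤ estimatorRisk π P l φ :=
    fun φ hφ => (lowerBound_antitone hρ.le hc.le I
      (le_iSup₂ (f := fun φ _ => smallBallEst π P l φ ρ) φ hφ)).trans (hΦ φ hφ (.inl hI))
  calc lowerBound ρ c I (smallBallClass π P l Φ ρ)
      ≤ ((lowerBound ρ c I (smallBallClass π P l Φ ρ)).toENNReal : EReal) := by
        rw [EReal.coe_toENNReal_eq_max]
        exact le_max_right _ _
    _ ≤ (⨅ φ ∈ Φ, estimatorRisk π P l φ : ℝ≥0∞) :=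
        EReal.coe_ennreal_le_coe_ennreal_iff.2 <| le_iInf₂ fun φ hφ => by
          simpa using EReal.toENNReal_le_toENNReal (h_risk φ hφ)

end Risk

end BayesLowerBound

theorem mainTheorem9 {𝒲 𝒳 𝒱 : Type*} [MeasurableSpace 𝒲] [MeasurableSpace 𝒳]
    [MeasurableSpace 𝒱] (π : Measure 𝒲) [IsProbabilityMeasure π]
    (P : Kernel 𝒲 𝒳) [IsMarkovKernel P]
    (l : 𝒲 → 𝒱 → ℝ≥0) (hl : Measurable (Function.uncurry l)) (ρ : ℝ) (hρ : 0 < ρ) :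
    -- Sibson's mutual information of order `α > 1`
    (∀ α : ℝ, 1 < α →
      (∀ φ : 𝒳 → 𝒱, Measurable φ →
        ((BayesLowerBound.sibsonMI α (BayesLowerBound.jointXW π P)) ≠ ⊤ ∨ BayesLowerBound.smallBallEst π P l φ ρ ≠ 0) →
        BayesLowerBound.lowerBound ρ ((α - 1) / α) (BayesLowerBound.sibsonMI α (BayesLowerBound.jointXW π P))
            (BayesLowerBound.smallBallEst π P l φ ρ)
          ≤ (BayesLowerBound.estimatorRisk π P l φ : EReal)) ∧
      (∀ Φ : Set (𝒳 → 𝒱), (∀ φ ∈ Φ, Measurable φ) →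
        (⨅ φ ∈ Φ, BayesLowerBound.estimatorRisk π P l φ) = BayesLowerBound.bayesianRisk π P l →
        ((BayesLowerBound.sibsonMI α (BayesLowerBound.jointXW π P)) ≠ ⊤ ∨ BayesLowerBound.smallBallClass π P l Φ ρ ≠ 0) →
        BayesLowerBound.lowerBound ρ ((α - 1) / α) (BayesLowerBound.sibsonMI α (BayesLowerBound.jointXW π P))
            (BayesLowerBound.smallBallClass π P l Φ ρ)
          ≤ (BayesLowerBound.bayesianRisk π P l : EReal))) ∧
    -- maximal leakage, the case `α → ∞`
    (∀ φ : 𝒳 → 𝒱, Measurable φ →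
      ((BayesLowerBound.maximalLeakage (BayesLowerBound.jointXW π P)) ≠ ⊤ ∨ BayesLowerBound.smallBallEst π P l φ ρ ≠ 0) →
      BayesLowerBound.lowerBound ρ 1 (BayesLowerBound.maximalLeakage (BayesLowerBound.jointXW π P))
          (BayesLowerBound.smallBallEst π P l φ ρ)
        ≤ (BayesLowerBound.estimatorRisk π P l φ : EReal)) ∧
    (∀ Φ : Set (𝒳 → 𝒱), (∀ φ ∈ Φ, Measurable φ) →
      (⨅ φ ∈ Φ, BayesLowerBound.estimatorRisk π P l φ) = BayesLowerBound.bayesianRisk π P l →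
      ((BayesLowerBound.maximalLeakage (BayesLowerBound.jointXW π P)) ≠ ⊤ ∨ BayesLowerBound.smallBallClass π P l Φ ρ ≠ 0) →
      BayesLowerBound.lowerBound ρ 1 (BayesLowerBound.maximalLeakage (BayesLowerBound.jointXW π P))
          (BayesLowerBound.smallBallClass π P l Φ ρ)
        ≤ (BayesLowerBound.bayesianRisk π P l : EReal)) := by
  refine ⟨fun α hα => ⟨fun φ hφ => ?_, fun Φ hΦ hR h => ?_⟩, fun φ hφ => ?_, fun Φ hΦ hR h => ?_⟩
  · exact BayesLowerBound.lowerBound_sibsonMI_le_estimatorRisk π P hl hφ hρ hα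
  · have hc : 0 < (α - 1) / α := div_pos (by linarith) (by linarith)
    rw [← hR]
    exact BayesLowerBound.lowerBound_smallBallClass_le_iInf_estimatorRisk π P hρ hc h fun φ hφ =>
      BayesLowerBound.lowerBound_sibsonMI_le_estimatorRisk π P hl (hΦ φ hφ) hρ hα
  · exact BayesLowerBound.lowerBound_maximalLeakage_le_estimatorRisk π P hl hφ hρ
  · rw [← hR]
    exact BayesLowerBound.lowerBound_smallBallClass_le_iInf_estimatorRisk π P hρ one_pos h
      fun φ hφ =>
        BayesLowerBound.lowerBound_maximalLeakage_le_estimatorRisk π P hl (hΦ φ hφ) hρ
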